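/- Let $X\subseteq\mathbb R^n$ be open with $0\in X$, and consider the control-affine system $\dot x=f(x)+g(x)u$, $u\in\mathbb R^m$, where $f$ and the columns $g_1,\dots,g_m$ of $g$ are $C^1$ on $X$. The target is the origin. For $i=1,\dots,K$ let $c_i,b_i:X\to\mathbb R$ be continuous functions describing the obstacles $X_{u_i}=\{x\in X: c_i(x)\le 0\}$ and the sensing regions $X_{b_i}=\{x\in X: b_i(x)\le 0\}\setminus X_{u_i}$. The unsafe set is $X_u=\bigcup_i X_{u_i}$, and $0\notin X_u$. The inverse bump functions are $$\Psi_i=\begin{cases}0&\text{on }X_{u_i},\\[2pt] \dfrac{e^{-1/m_i}}{e^{-1/m_i}+e^{-1/(1-m_i)}},\quad m_i=\dfrac{c_i}{c_i-b_i}, &\text{on }X_{b_i},\\[6pt] 1&\text{elsewhere}\end{cases}$$ (with $e^{-1/(1-m_i)}:=0$ where $m_i=1$). Assume that each $\Psi_i$ is $C^1$ on $X$, as is the case when $c_i,b_i$ are $C^1$ and $b_i<0$ on $X_{u_i}$. Let $P$ be a symmetric positive definite matrix, $D(x)=x^\top P x$, $\alpha>0$, and $$\rho(x)=\frac{\Psi(x)}{D(x)^\alpha},\qquad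 \Psi=\prod_{i=1}^K\Psi_i .$$ For $\eta>0$ put $\bar X_\eta=X\setminus\{x:|x|<\eta\}$, and assume that $\rho$ is integrable on $\bar X_\eta$ for every $\eta>0$ (automatic if $X$ is bounded or $2\alpha>n$). Let $X_0\subseteq X\setminus\{0\}$ be a measurable initial set. Suppose that there are a $C^1$ feedback $k:X\to\mathbb R^m$, for which the closed-loop system $\dot x=f(x)+g(x)k(x)$ has a solution in $X$ defined for all $t\ge 0$ from every $x_0\in X_0$, and a number $\lambda>0$ such that $$\nabla\cdot\big((f+gk)\rho\big)\ge 0\quad\text{for a.e. }x\in\bar X_\eta\text{, for every }\eta>0,$$ $$\nabla\cdot\big((f+gk)\rho\big)\ge\lambda\quad\text{for every }x\in X_0 .$$ Then the feedback $u=k(x)$ solves the almost everywhere safe navigation problem: for Lebesgue-almost every $x_0\in X_0$, the solution $x(t)$ of $\dot x=f(x)+g(x)k(x)$ in $X$ with $x(0)=x_0$ exists for all $t\ge0$ and satisfies $x(t)\to 0$ as $t\to\infty$ and $x(t)\notin X_u$ for all $t\ge 0$. -/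

import Mathlib

open MeasureTheory Filter Topology Set

namespace SafeNavigation

/-- The state space `ℝⁿ` with its Euclidean norm and Lebesgue measure. -/
abbrev State (n : ℕ) : Type := EuclideanSpace ℝ (Fin n)

/-- The divergence `∇ · V = ∑ᵢ ∂Vᵢ/∂xᵢ` of a vector field on `ℝⁿ`. -/
noncomputable def divergence {n : ℕ} (V : State n → State n) (x : State n) : ℝ :=
  ∑ i : Fin n, fderiv ℝ V x (EuclideanSpace.single i (1 : ℝ)) i

/-- The closed-loop vector field `f + g k = f + ∑ⱼ kⱼ gⱼ`, where `g = (g₁, …, gₘ)`. -/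
noncomputable def closedLoop {n m : ℕ} (f : State n → State n) (g : Fin m → State n → State n)
    (k : State n → EuclideanSpace ℝ (Fin m)) (x : State n) : State n :=
  f x + ∑ j : Fin m, k x j • g j x

/-- The region to avoid: the union of the obstacles `{x ∈ X | cᵢ x ≤ 0}`. -/
def obstacleRegion {n K : ℕ} (X : Set (State n)) (c : Fin K → State n → ℝ) : Set (State n) :=
  ⋃ i : Fin K, {x | x ∈ X ∧ c i x ≤ 0}

/-- The inverse bump function of one obstacle: `0` on the obstacle `{c ≤ 0}`; on the sensing region
`{b ≤ 0} \ {c ≤ 0}` it is `exp(-1/m) / (exp(-1/m) + exp(-1/(1-m)))` with `m = c / (c - b)`; and `1`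
elsewhere. On the sensing region `0 < m ≤ 1`, and `Real.smoothTransition` is this quotient, with the
limit value `exp(-1/(1-m)) = 0` at `m = 1`. -/
noncomputable def inverseBump {n : ℕ} (c b : State n → ℝ) (x : State n) : ℝ :=
  if c x ≤ 0 then 0
  else if b x ≤ 0 then Real.smoothTransition (c x / (c x - b x))
  else 1

/-- The squared distance `D x = xᵀ P x` to the target, the origin. -/
noncomputable def quadDist {n : ℕ} (P : Matrix (Fin n) (Fin n) ℝ) (x : State n) : ℝ :=
  x.ofLp ⬝ᵥ P.mulVec x.ofLp

/-- The density `ρ = Ψ / D ^ α`, where `Ψ` is the product of the inverse bump functions.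
(It is only used away from the origin, where `D > 0`.) -/
noncomputable def density {n K : ℕ} (c b : Fin K → State n → ℝ) (P : Matrix (Fin n) (Fin n) ℝ)
    (α : ℝ) (x : State n) : ℝ :=
  (∏ i : Fin K, inverseBump (c i) (b i) x) / quadDist P x ^ α

/-- `φ`, restricted to `[0, ∞)`, is a solution in `X` of `ẋ = F x` with `φ 0 = x₀`. -/
structure IsForwardTrajectory {n : ℕ} (X : Set (State n)) (F : State n → State n)
    (x₀ : State n) (φ : ℝ → State n) : Prop where
  init : φ 0 = x₀
  mem : ∀ t, 0 ≤ t → φ t ∈ X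
  deriv : ∀ t, 0 ≤ t → HasDerivWithinAt φ (F (φ t)) (Ici 0) t

/-- The system `ẋ = F x` on `X` solves the almost everywhere safe navigation problem with initial
set `X₀`, target the origin, and region to avoid `Xu`: for Lebesgue-almost every `x₀ ∈ X₀` there is
a trajectory on `[0, ∞)` from `x₀`, and it tends to the origin and never meets `Xu`. -/
def SolvesAESafeNavigation {n : ℕ} (X : Set (State n)) (F : State n → State n)
    (X₀ Xu : Set (State n)) : Prop :=
  ∀ᵐ x₀ ∂(volume.restrict X₀),
    (∃ φ, IsForwardTrajectory X F x₀ φ) ∧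
      ∀ φ, IsForwardTrajectory X F x₀ φ →
        Tendsto φ atTop (𝓝 0) ∧ ∀ t, 0 ≤ t → φ t ∉ Xu

end SafeNavigation

open SafeNavigation

/-! Regard ρ as the density of a substance carried by the flow of F = f + g k. Along a trajectory φ,
let M solve the linearised equation with M(0) = 1. By Liouville's formula, det M(t) · ρ(φ(t)) has
derivative det M(t) · ∇·(ρF)(φ(t)) ≥ 0, so the flow expands ρ
(`exists_hasFDerivWithinAt_density_le`). Safety and convergence both follow from this.

Safety: ρ stays positive once it is positive, and it vanishes on the obstacles. It is positive on
X₀, since a zero of ρ is a minimum, where ∇ρ = 0 and the divergence would be 0 instead of at least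
λ. This holds for every initial state in X₀.

Convergence: on a set invariant under the time-one map T and containing X₀, the measure μ = ρ dx
dominates its own image under T plus a measure created from X₀. Iterating, all transported layers of
created mass fit together under μ. Since μ is finite outside each ball about 0, Borel–Cantelli lets
almost every orbit from X₀ visit that region only finitely often (`ae_eventually_iterate_notMem`).
Continuous dependence fills in the times between integers.

Trajectories must avoid the singularity of ρ, and F 0 = 0 ensures this. It is a consequence of the
hypotheses: if v = F 0 were nonzero, ρ would fall so steeply along v that the divergence would be
negative at s v for small s > 0 (`eq_zero_of_divergence_nonneg`). -/

namespace SafeNavigation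

/-! ### Measure theory: expanding maps and finitely many visits -/

/-- Every trajectory visits a set of finite measure finitely often, almost everywhere for a measure
`ν` that the map `T` creates on top of the transported measure. -/
theorem measure_frequently_iterate_mem_eq_zero {α : Type*} [MeasurableSpace α]
    {μ ν : Measure α} {T : α → α} (hT : Measurable T) (h : ν + μ.map T ≤ μ)
    {B : Set α} (hB : MeasurableSet B) (hμB : μ B ≠ ⊤) :
    ν {x | ∃ᶠ j in atTop, T^[j] x ∈ B} = 0 := by
  -- Substituting μ ≥ ν + T_* μ into itself N times: the first N transported copies of ν fit
  -- together under μ.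
  have key : ∀ N : ℕ, ∑ j ∈ Finset.range N, ν.map (T^[j]) ≤ μ := by
    intro N
    induction N with
    | zero => simpa using Measure.zero_le μ
    | succ N ih =>
      rw [Finset.sum_range_succ']
      have h1 : ∑ j ∈ Finset.range N, ν.map (T^[j + 1])
          = (∑ j ∈ Finset.range N, ν.map (T^[j])).map T := by
        ext s hs
        rw [Measure.map_apply hT hs]
        simp only [Measure.coe_finsetSum, Finset.sum_apply]
        refine Finset.sum_congr rfl fun j _ => ?_
        rw [Measure.map_apply (hT.iterate _) hs, Measure.map_apply (hT.iterate _) (hT hs),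
          Function.iterate_succ', preimage_comp]
      rw [h1]
      calc _ ≤ μ.map T + ν := by
            refine add_le_add (Measure.map_mono ih hT) ?_
            simp [Measure.map_id]
        _ ≤ μ := by rwa [add_comm]
  -- Borel–Cantelli: the measures ν (T^[j] ⁻¹' B) have sum at most μ B.
  apply measure_setOfPred_frequently_eq_zero
  refine ne_top_of_le_ne_top hμB ?_
  refine ENNReal.tsum_le_of_sum_range_le fun N => ?_
  have := key N B
  simp only [Measure.coe_finsetSum, Finset.sum_apply] at this
  refine le_trans (le_of_eq (Finset.sum_congr rfl fun j _ => ?_)) this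
  rw [Measure.map_apply (hT.iterate _) hB]
  rfl

/-- If an injective differentiable map `T` of a set `S` expands the density `ρ`, strictly so on
`S₀ ⊆ S`, then almost every orbit from `S₀` eventually leaves a set of finite `ρ`-measure. -/
theorem ae_eventually_iterate_notMem {E : Type*} [NormedAddCommGroup E] [NormedSpace ℝ E]
    [FiniteDimensional ℝ E] [MeasurableSpace E] [BorelSpace E] (vol : Measure E)
    [vol.IsAddHaarMeasure] {T : E → E} {T' : E → E →L[ℝ] E} {S S₀ B : Set E} {ρ : E → ENNReal}
    (hS : MeasurableSet S) (hS₀ : MeasurableSet S₀) (hS₀S : S₀ ⊆ S) (hTS : MapsTo T S S)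
    (hinj : InjOn T S) (hT : ∀ x ∈ S, HasFDerivWithinAt T (T' x) S x) (hρ : Measurable ρ)
    (hle : ∀ x ∈ S, ρ x ≤ ENNReal.ofReal |(T' x).det| * ρ (T x))
    (hlt : ∀ x ∈ S₀, ρ x < ENNReal.ofReal |(T' x).det| * ρ (T x))
    (hB : MeasurableSet B) (hρB : ∫⁻ x in B ∩ S, ρ x ∂vol ≠ ⊤) :
    ∀ᵐ x ∂(vol.restrict S₀), ∀ᶠ j in atTop, T^[j] x ∉ B := by
  classical
  -- T is controlled only on S; extending by the identity gives a measurable map with the same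
  -- orbits from S.
  set U : E → E := S.piecewise T id with hU
  have hTc : ContinuousOn T S := fun x hx => (hT x hx).continuousWithinAt
  have hUS : EqOn U T S := fun x hx => piecewise_eq_of_mem _ _ _ hx
  have hUm : Measurable U := by
    refine measurable_of_restrict_of_restrict_compl hS ?_ ?_
    · rw [hU, domRestrict_piecewise]
      exact (continuousOn_iff_continuous_domRestrict.1 hTc).measurable
    · rw [hU, domRestrict_piecewise_compl]
      exact measurable_id.comp measurable_subtype_coe
  have hit : ∀ j, ∀ x ∈ S, U^[j] x = T^[j] x ∧ T^[j] x ∈ S := by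
    intro j x hx
    induction j with
    | zero => exact ⟨rfl, hx⟩
    | succ j ih =>
      rw [Function.iterate_succ_apply', Function.iterate_succ_apply', ih.1]
      exact ⟨hUS ih.2, hTS ih.2⟩
  set J : E → ENNReal := fun x => ENNReal.ofReal |(T' x).det| * ρ (U x) with hJ
  have hJm : AEMeasurable J (vol.restrict S) :=
    (aemeasurable_ofReal_abs_det_fderivWithin vol hS hT).mul (hρ.comp hUm).aemeasurable
  have hJm₀ : AEMeasurable J (vol.restrict S₀) := hJm.mono_set hS₀S
  have hJle : ∀ x ∈ S, ρ x ≤ J x := fun x hx => by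
    simpa only [hJ, hUS hx] using hle x hx
  have hJlt : ∀ x ∈ S₀, ρ x < J x := fun x hx => by
    simpa only [hJ, hUS (hS₀S hx)] using hlt x hx
  set μ : Measure E := (vol.restrict S).withDensity ρ with hμ
  set κ : Measure E := (vol.restrict S₀).withDensity (J - ρ) with hκ
  -- On S, κ and μ together have density at most J, and by change of variables T carries J dx to ρ
  -- dx on T(S) ⊆ S.
  have hmain : κ.map U + μ.map U ≤ μ := by
    rw [Measure.le_iff]
    intro Y hY
    have hV : MeasurableSet (U ⁻¹' Y) := hUm hY
    rw [Measure.add_apply, Measure.map_apply hUm hY, Measure.map_apply hUm hY, hμ, hκ,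
      withDensity_apply _ hV, withDensity_apply _ hV, withDensity_apply _ hY,
      Measure.restrict_restrict hV, Measure.restrict_restrict hV, Measure.restrict_restrict hY]
    have hVS : MeasurableSet (U ⁻¹' Y ∩ S) := hV.inter hS
    calc ∫⁻ x in U ⁻¹' Y ∩ S₀, (J - ρ) x ∂vol + ∫⁻ x in U ⁻¹' Y ∩ S, ρ x ∂vol
        ≤ ∫⁻ x in U ⁻¹' Y ∩ S, (J - ρ) x ∂vol + ∫⁻ x in U ⁻¹' Y ∩ S, ρ x ∂vol := by
          gcongr
      _ = ∫⁻ x in U ⁻¹' Y ∩ S, ((J - ρ) x + ρ x) ∂vol := (lintegral_add_right _ hρ).symm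
      _ = ∫⁻ x in U ⁻¹' Y ∩ S, ENNReal.ofReal |(T' x).det| * ρ (T x) ∂vol := by
          refine setLIntegral_congr_fun hVS fun x hx => ?_
          simp only [Pi.sub_apply]
          rw [tsub_add_cancel_of_le (hJle x hx.2), hJ, ← hUS hx.2]
      _ = ∫⁻ x in T '' (U ⁻¹' Y ∩ S), ρ x ∂vol :=
          (lintegral_image_eq_lintegral_abs_det_fderiv_mul vol hVS
            (fun x hx => (hT x hx.2).mono inter_subset_right)
            (hinj.mono inter_subset_right) ρ).symm
      _ ≤ ∫⁻ x in Y ∩ S, ρ x ∂vol := by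
          refine lintegral_mono_set ?_
          rintro _ ⟨x, hx, rfl⟩
          exact ⟨by simpa only [mem_preimage, hUS hx.2] using hx.1, hTS hx.2⟩
  have hμB : μ B ≠ ⊤ := by
    rwa [hμ, withDensity_apply _ hB, Measure.restrict_restrict hB]
  have hfreq := measure_frequently_iterate_mem_eq_zero hUm hmain hB hμB
  have hset : MeasurableSet {x | ∃ᶠ j in atTop, U^[j] x ∈ B} := by
    convert MeasurableSet.measurableSet_limsup fun j => hUm.iterate j hB using 1
    ext x
    simp [mem_limsup_iff_frequently_mem]
  rw [Measure.map_apply hUm hset, hκ,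
    withDensity_apply_eq_zero' (hJm₀.sub hρ.aemeasurable), Measure.restrict_apply₀'
      hS₀.nullMeasurableSet] at hfreq
  rw [ae_restrict_iff' hS₀, ae_iff]
  -- Since J - ρ > 0 on S₀, a κ-null subset of S₀ is `vol`-null.
  refine measure_mono_null ?_ hfreq
  intro x hx
  simp only [mem_ofPred_eq, Classical.not_imp, not_eventually, not_not] at hx
  refine ⟨⟨?_, ?_⟩, hx.1⟩
  · exact (tsub_pos_of_lt (hJlt x hx.1)).ne'
  · simp only [mem_preimage, mem_ofPred_eq]
    rw [frequently_atTop] at hx ⊢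
    intro a
    -- The created mass `κ.map U` sits at T x, not at x, hence the index shift by one.
    obtain ⟨b, hab, hb⟩ := hx.2 (a + 1)
    obtain ⟨j, rfl⟩ : ∃ j, b = j + 1 := ⟨b - 1, by omega⟩
    refine ⟨j, by omega, ?_⟩
    rwa [← Function.iterate_succ_apply, (hit _ x (hS₀S hx.1)).1]

/-! ### Liouville's formula -/

/-- Derivative of a determinant along a solution of a linear matrix equation. -/
theorem hasDerivWithinAt_det {n : ℕ} {M : ℝ → Matrix (Fin n) (Fin n) ℝ}
    {A : Matrix (Fin n) (Fin n) ℝ} {s : Set ℝ} {t : ℝ}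
    (h : ∀ i j, HasDerivWithinAt (fun τ => M τ i j) ((A * M t) i j) s t) :
    HasDerivWithinAt (fun τ => (M τ).det) (A.trace * (M t).det) s t := by
  let d : ContinuousMultilinearMap ℝ (fun _ : Fin n => Fin n → ℝ) ℝ :=
    { (Matrix.detRowAlternating (n := Fin n) (R := ℝ)).toMultilinearMap with
      cont := Continuous.matrix_det continuous_id }
  have hM : HasDerivWithinAt (fun τ => (M τ : Fin n → Fin n → ℝ))
      (A * M t : Matrix (Fin n) (Fin n) ℝ) s t :=
    hasDerivWithinAt_pi.2 fun i => hasDerivWithinAt_pi.2 fun j => h i j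
  have := (d.hasFDerivAt (x := M t)).comp_hasDerivWithinAt t hM
  suffices hd' : (d.linearDeriv (M t)) (A * M t) = A.trace * (M t).det by
    rw [← hd']
    exact this
  refine (ContinuousMultilinearMap.linearDeriv_apply d (fun i => M t i)
    (fun i => (A * M t) i)).trans ?_
  rw [Matrix.trace, Finset.sum_mul]
  refine Finset.sum_congr rfl fun i _ => ?_
  -- Row i of A * M combines the rows of M; put in place of row i, only its A i i multiple of row i
  -- contributes to the determinant.
  have hrow : (A * M t) i = ∑ k, A i k • M t k := by
    ext j
    simp [Matrix.mul_apply]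
  rw [hrow]
  exact Matrix.det_updateRow_sum (M t) i (A i)

/-- Liouville's formula for the determinant of a solution of `M' = A ∘ M`. -/
theorem hasDerivWithinAt_clm_det {E : Type*} [NormedAddCommGroup E] [NormedSpace ℝ E]
    [FiniteDimensional ℝ E] {M : ℝ → E →L[ℝ] E} {A : E →L[ℝ] E} {s : Set ℝ} {t : ℝ}
    (h : HasDerivWithinAt M (A ∘L M t) s t) :
    HasDerivWithinAt (fun τ => (M τ).det) (LinearMap.trace ℝ E A * (M t).det) s t := by
  let e := Module.finBasis ℝ E
  have hdet : ∀ N : E →L[ℝ] E, N.det = (LinearMap.toMatrix e e (N : E →ₗ[ℝ] E)).det :=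
    fun N => (LinearMap.det_toMatrix e _).symm
  simp only [hdet]
  rw [LinearMap.trace_eq_matrix_trace ℝ e]
  refine hasDerivWithinAt_det fun i j => ?_
  rw [← LinearMap.toMatrix_comp]
  simp only [LinearMap.toMatrix_apply]
  have h1 : HasDerivWithinAt (fun τ => M τ (e j)) ((A ∘L M t) (e j)) s t := by
    simpa using h.clm_apply (hasDerivWithinAt_const t s (e j))
  exact (LinearMap.toContinuousLinearMap (e.coord i)).hasFDerivAt.comp_hasDerivWithinAt t h1

/-! ### Global solutions of linear differential equations -/

/-- Solutions of a linear differential equation exist on every short interval. -/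
theorem exists_linear_ODE_step {V : Type*} [NormedAddCommGroup V] [NormedSpace ℝ V]
    [CompleteSpace V] {A : ℝ → V →L[ℝ] V} {C : NNReal} {a b : ℝ} (hab : a ≤ b)
    (hA : ContinuousOn A (Icc a b)) (hC : ∀ t ∈ Icc a b, ‖A t‖ ≤ C) (hb : C * (b - a) ≤ 1 / 2)
    (v₀ : V) :
    ∃ M : ℝ → V, M a = v₀ ∧ ContinuousOn M (Icc a b) ∧
      ∀ t ∈ Ico a b, HasDerivWithinAt M (A t (M t)) (Ici t) t := by
  -- In the ball of radius ‖v₀‖ + 1 about v₀ the speed is at most C(2‖v₀‖ + 1). As C(b - a) ≤ 1/2,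
  -- the displacement is at most ‖v₀‖ + 1/2, so the admissible step length does not depend on v₀.
  have hPL : IsPicardLindelof (fun t v => A t v) (⟨a, le_rfl, hab⟩ : Icc a b) v₀
      (‖v₀‖₊ + 1) 0 (C * (2 * ‖v₀‖₊ + 1)) C := by
    refine ⟨fun t ht => ?_, fun x _ => hA.clm_apply continuousOn_const, fun t ht x hx => ?_, ?_⟩
    · exact ((A t).lipschitz.weaken (by exact_mod_cast hC t ht)).lipschitzOnWith
    · have hx' : ‖x‖ ≤ 2 * ‖v₀‖ + 1 := by
        have h1 : ‖x - v₀‖ ≤ ‖v₀‖ + 1 := by simpa [dist_eq_norm] using hx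
        have h2 := norm_le_norm_add_norm_sub' x v₀
        linarith
      calc ‖A t x‖ ≤ ‖A t‖ * ‖x‖ := (A t).le_opNorm x
        _ ≤ C * (2 * ‖v₀‖ + 1) := by
          gcongr
          exact hC t ht
        _ = _ := by simp
    · have h0 : max (b - a) (a - a) = b - a := max_eq_left (by linarith)
      simp only [h0]
      push_cast
      nlinarith [norm_nonneg v₀]
  obtain ⟨M, hM0, hM⟩ := hPL.exists_eq_forall_mem_Icc_hasDerivWithinAt₀
  refine ⟨M, hM0, fun t ht => (hM t ht).continuousWithinAt, fun t ht => ?_⟩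
  exact (hM t ⟨ht.1, ht.2.le⟩).mono_of_mem_nhdsWithin (Icc_mem_nhdsGE_of_mem ht)

/-- Solutions of a linear differential equation exist globally. -/
theorem exists_linear_ODE {V : Type*} [NormedAddCommGroup V] [NormedSpace ℝ V]
    [CompleteSpace V] {A : ℝ → V →L[ℝ] V} (hA : ContinuousOn A (Icc 0 1)) (v₀ : V) :
    ∃ M : ℝ → V, M 0 = v₀ ∧ ContinuousOn M (Icc 0 1) ∧
      ∀ t ∈ Ico (0 : ℝ) 1, HasDerivWithinAt M (A t (M t)) (Ici t) t := by
  obtain ⟨C', hC'⟩ := isCompact_Icc.exists_bound_of_continuousOn hA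
  set C : NNReal := C'.toNNReal
  have hC : ∀ t ∈ Icc (0 : ℝ) 1, ‖A t‖ ≤ C := fun t ht => (hC' t ht).trans (Real.le_coe_toNNReal _)
  -- Steps of length 1/N satisfy C/N ≤ 1/2, whatever value has been reached.
  obtain ⟨N, hN⟩ := exists_nat_gt (2 * (C : ℝ))
  have hN0 : (0 : ℝ) < N := lt_of_le_of_lt (by positivity) hN
  have key : ∀ k : ℕ, k ≤ N → ∃ M : ℝ → V, M 0 = v₀ ∧ ContinuousOn M (Icc 0 (k / N : ℝ)) ∧
      ∀ t ∈ Ico (0 : ℝ) (k / N), HasDerivWithinAt M (A t (M t)) (Ici t) t := by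
    intro k
    induction k with
    | zero => exact fun _ => ⟨fun _ => v₀, rfl, continuousOn_const, fun t ht => by simp at ht⟩
    | succ k ih =>
      intro hk
      obtain ⟨M, hM0, hMc, hM⟩ := ih (by omega)
      set a : ℝ := k / N with ha
      set b : ℝ := ((k + 1 : ℕ) : ℝ) / N with hb
      have ha0 : 0 ≤ a := by positivity
      have hba : b - a = 1 / N := by rw [ha, hb]; push_cast; ring
      have hab : a ≤ b := by
        have : (0 : ℝ) ≤ 1 / N := by positivity
        linarith
      have hb1 : b ≤ 1 := by
        rw [hb, div_le_one hN0]
        exact_mod_cast hk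
      have hsub : Icc a b ⊆ Icc 0 1 := Icc_subset_Icc ha0 hb1
      obtain ⟨Q, hQa, hQc, hQ⟩ := exists_linear_ODE_step hab (hA.mono hsub)
        (fun t ht => hC t (hsub ht)) (by
          rw [hba, mul_one_div, div_le_iff₀ hN0]
          linarith) (M a)
      set R : ℝ → V := fun t => if t ≤ a then M t else Q t with hR
      have hRM : ∀ τ, τ ≤ a → R τ = M τ := fun τ hτ => if_pos hτ
      have hRQ : ∀ τ, a ≤ τ → R τ = Q τ := by
        intro τ hτ
        simp only [hR]
        split_ifs with h
        · rw [le_antisymm h hτ, hQa]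
        · rfl
      refine ⟨R, (hRM 0 ha0).trans hM0, ?_, fun t ht => ?_⟩
      · rw [← Icc_union_Icc_eq_Icc ha0 hab]
        exact (hMc.congr fun τ hτ => hRM τ hτ.2).union_of_isClosed
          (hQc.congr fun τ hτ => hRQ τ hτ.1) isClosed_Icc isClosed_Icc
      -- Only right derivatives are required, so at the junction a only Q matters.
      · by_cases hta : t < a
        · have hev : R =ᶠ[𝓝[≥] t] M := by
            filter_upwards [mem_nhdsWithin_of_mem_nhds (Iio_mem_nhds hta)] with τ hτ
            exact hRM τ (mem_Iio.1 hτ).le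
          rw [hRM t hta.le]
          exact (hM t ⟨ht.1, hta⟩).congr_of_eventuallyEq hev (hRM t hta.le)
        · have hta' : a ≤ t := not_lt.1 hta
          rw [hRQ t hta']
          exact (hQ t ⟨hta', ht.2⟩).congr (fun τ hτ => hRQ τ (hta'.trans hτ)) (hRQ t hta')
  obtain ⟨M, h0, hc, hd⟩ := key N le_rfl
  rw [div_self hN0.ne'] at hc hd
  exact ⟨M, h0, hc, hd⟩

/-! ### Uniform first-order estimates for C¹ fields -/

section Expansion

variable {E : Type*} [NormedAddCommGroup E] [NormedSpace ℝ E] {X : Set E} {F : E → E}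

theorem contDiffAt_of_isOpen (hX : IsOpen X) (hF : ContDiffOn ℝ 1 F X) {x : E} (hx : x ∈ X) :
    ContDiffAt ℝ 1 F x :=
  hF.contDiffAt (hX.mem_nhds hx)

theorem exists_lipschitzOnWith_of_isCompact (hX : IsOpen X) (hF : ContDiffOn ℝ 1 F X)
    {K : Set E} (hK : IsCompact K) (hKX : K ⊆ X) : ∃ C, LipschitzOnWith C F K := by
  refine LocallyLipschitzOn.exists_lipschitzOnWith_of_compact hK fun x hx => ?_
  obtain ⟨C, t, ht, h⟩ := (contDiffAt_of_isOpen hX hF (hKX hx)).exists_lipschitzOnWith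
  exact ⟨C, t, mem_nhdsWithin_of_mem_nhds ht, h⟩

/-- First-order Taylor bounds for a `C¹` map, uniform over a compact set of base points. -/
theorem exists_uniform_expansion [ProperSpace E] (hX : IsOpen X) (hF : ContDiffOn ℝ 1 F X)
    {K : Set E} (hK : IsCompact K) (hKX : K ⊆ X) :
    ∃ C : ℝ, 0 ≤ C ∧ (∀ p ∈ K, ‖fderiv ℝ F p‖ ≤ C) ∧
      (∃ δ > 0, ∀ p ∈ K, ∀ z ∈ Metric.closedBall p δ, ‖F z - F p‖ ≤ C * ‖z - p‖) ∧
      ∀ ε > 0, ∃ r > 0, ∀ p ∈ K, ∀ z ∈ Metric.closedBall p r,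
        ‖F z - F p - fderiv ℝ F p (z - p)‖ ≤ ε * ‖z - p‖ := by
  -- A compact thickening of K inside X contains all the small balls, so boundedness and uniform
  -- continuity of the derivative there serve every base point at once.
  obtain ⟨δ, hδ, hδX⟩ := hK.exists_cthickening_subset_open hX hKX
  have hball : ∀ p ∈ K, Metric.closedBall p δ ⊆ Metric.cthickening δ K :=
    fun p hp => Metric.closedBall_subset_cthickening hp δ
  have hc : IsCompact (Metric.cthickening δ K) := hK.cthickening
  have hcont : ContinuousOn (fderiv ℝ F) (Metric.cthickening δ K) :=
    (hF.continuousOn_fderiv_of_isOpen hX le_rfl).mono hδX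
  have hdiff : ∀ p ∈ K, ∀ s ≤ δ, ∀ z ∈ Metric.closedBall p s,
      HasFDerivWithinAt F (fderiv ℝ F z) (Metric.closedBall p s) z := fun p hp s hs z hz =>
    ((contDiffAt_of_isOpen hX hF (hδX (hball p hp (Metric.closedBall_subset_closedBall hs
      hz)))).differentiableAt one_ne_zero).hasFDerivAt.hasFDerivWithinAt
  obtain ⟨C, hC⟩ := hc.exists_bound_of_continuousOn hcont
  refine ⟨max C 0, le_max_right _ _, fun p hp => (hC p (hball p hp (Metric.mem_closedBall_self
    hδ.le))).trans (le_max_left _ _), ⟨δ, hδ, fun p hp z hz => ?_⟩, fun ε hε => ?_⟩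
  · exact (convex_closedBall p δ).norm_image_sub_le_of_norm_hasFDerivWithin_le
      (hdiff p hp δ le_rfl) (fun w hw => (hC w (hball p hp hw)).trans (le_max_left _ _))
      (Metric.mem_closedBall_self hδ.le) hz
  · obtain ⟨r, hr, h⟩ := Metric.uniformContinuousOn_iff.1
      (hc.uniformContinuousOn_of_continuous hcont) ε hε
    have hs : 0 < min (r / 2) δ := by positivity
    refine ⟨min (r / 2) δ, hs, fun p hp z hz => ?_⟩
    refine (convex_closedBall p _).norm_image_sub_le_of_norm_hasFDerivWithin_le'
      (hdiff p hp _ (min_le_right _ _)) (fun w hw => ?_) (Metric.mem_closedBall_self hs.le) hz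
    rw [← dist_eq_norm]
    refine (h w (hball p hp (Metric.closedBall_subset_closedBall (min_le_right _ _) hw)) p
      (hball p hp (Metric.mem_closedBall_self hδ.le)) ?_).le
    have := Metric.mem_closedBall.1 hw
    linarith [min_le_left (r / 2) δ]

end Expansion

/-! ### Uniqueness and differentiable dependence of trajectories -/

section Trajectories

variable {n : ℕ} {X : Set (State n)} {F : State n → State n} {x y : State n} {φ ψ : ℝ → State n}

theorem IsForwardTrajectory.continuousOn (h : IsForwardTrajectory X F x φ) :
    ContinuousOn φ (Ici 0) :=
  fun t ht => (h.deriv t ht).continuousWithinAt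

theorem IsForwardTrajectory.continuousOn_Icc (h : IsForwardTrajectory X F x φ) (T : ℝ) :
    ContinuousOn φ (Icc 0 T) :=
  h.continuousOn.mono fun _ ht => ht.1

theorem IsForwardTrajectory.deriv_right (h : IsForwardTrajectory X F x φ) {t : ℝ} (ht : 0 ≤ t) :
    HasDerivWithinAt φ (F (φ t)) (Ici t) t :=
  (h.deriv t ht).mono (Ici_subset_Ici.2 ht)

theorem IsForwardTrajectory.shift (h : IsForwardTrajectory X F x φ) {s : ℝ} (hs : 0 ≤ s) :
    IsForwardTrajectory X F (φ s) (fun t => φ (s + t)) where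
  init := by simp
  mem t ht := h.mem _ (add_nonneg hs ht)
  deriv t ht := by
    have h1 : HasDerivWithinAt (fun t : ℝ => s + t) 1 (Ici 0) t :=
      (hasDerivWithinAt_id t _).const_add s
    have h2 := (h.deriv (s + t) (add_nonneg hs ht)).scomp t h1
      (fun τ hτ => add_nonneg hs (mem_Ici.1 hτ))
    rwa [one_smul] at h2

theorem IsForwardTrajectory.exists_lipschitz (hX : IsOpen X) (hF : ContDiffOn ℝ 1 F X)
    (hφ : IsForwardTrajectory X F x φ) (hψ : IsForwardTrajectory X F y ψ) (T : ℝ) :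
    ∃ C, LipschitzOnWith C F (φ '' Icc 0 T ∪ ψ '' Icc 0 T) := by
  refine exists_lipschitzOnWith_of_isCompact hX hF
    ((isCompact_Icc.image_of_continuousOn (hφ.continuousOn_Icc T)).union
      (isCompact_Icc.image_of_continuousOn (hψ.continuousOn_Icc T))) ?_
  rintro _ (⟨t, ht, rfl⟩ | ⟨t, ht, rfl⟩)
  exacts [hφ.mem t ht.1, hψ.mem t ht.1]

theorem IsForwardTrajectory.unique (hX : IsOpen X) (hF : ContDiffOn ℝ 1 F X)
    (hφ : IsForwardTrajectory X F x φ) (hψ : IsForwardTrajectory X F x ψ) {t : ℝ} (ht : 0 ≤ t) :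
    φ t = ψ t := by
  obtain ⟨C, hC⟩ := hφ.exists_lipschitz hX hF hψ t
  exact ODE_solution_unique_of_mem_Icc_right (v := fun _ => F)
    (s := fun _ => φ '' Icc 0 t ∪ ψ '' Icc 0 t) (fun _ _ => hC) (hφ.continuousOn_Icc t)
    (fun s hs => hφ.deriv_right hs.1)
    (fun s hs => Or.inl (mem_image_of_mem _ (Ico_subset_Icc_self hs))) (hψ.continuousOn_Icc t)
    (fun s hs => hψ.deriv_right hs.1)
    (fun s hs => Or.inr (mem_image_of_mem _ (Ico_subset_Icc_self hs)))
    (hφ.init.trans hψ.init.symm) ⟨ht, le_rfl⟩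

/-- Uniqueness in reversed time makes the time-one map injective and forbids reaching an equilibrium
in finite time. -/
theorem IsForwardTrajectory.unique_backward (hX : IsOpen X) (hF : ContDiffOn ℝ 1 F X)
    (hφ : IsForwardTrajectory X F x φ) (hψ : IsForwardTrajectory X F y ψ) {t : ℝ} (ht : 0 ≤ t)
    (h : φ t = ψ t) : x = y := by
  obtain ⟨C, hC⟩ := hφ.exists_lipschitz hX hF hψ t
  have hd : ∀ {z : State n} {χ : ℝ → State n}, IsForwardTrajectory X F z χ → ∀ s ∈ Ioc 0 t,
      HasDerivWithinAt χ (F (χ s)) (Iic s) s := fun hχ s hs =>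
    ((hχ.deriv s hs.1.le).hasDerivAt (Ici_mem_nhds hs.1)).hasDerivWithinAt
  have := ODE_solution_unique_of_mem_Icc_left (v := fun _ => F)
    (s := fun _ => φ '' Icc 0 t ∪ ψ '' Icc 0 t) (fun _ _ => hC) (hφ.continuousOn_Icc t)
    (hd hφ)
    (fun s hs => Or.inl (mem_image_of_mem _ (Ioc_subset_Icc_self hs))) (hψ.continuousOn_Icc t)
    (hd hψ)
    (fun s hs => Or.inr (mem_image_of_mem _ (Ioc_subset_Icc_self hs))) h ⟨le_rfl, ht⟩
  rwa [hφ.init, hψ.init] at this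

/-- Continuous dependence on the initial state on `[0, 1]`. -/
theorem IsForwardTrajectory.norm_sub_le (hφ : IsForwardTrajectory X F x φ) {C δ : ℝ} (hC : 0 ≤ C)
    (hL : ∀ t ∈ Icc (0 : ℝ) 1, ∀ z ∈ Metric.closedBall (φ t) δ,
      ‖F z - F (φ t)‖ ≤ C * ‖z - φ t‖)
    (hψ : IsForwardTrajectory X F y ψ) (hxy : ‖y - x‖ * Real.exp C < δ) :
    ∀ t ∈ Icc (0 : ℝ) 1, ‖ψ t - φ t‖ ≤ ‖y - x‖ * Real.exp C := by
  have hcont : ContinuousOn (fun t => ψ t - φ t) (Icc 0 1) :=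
    (hψ.continuousOn_Icc 1).sub (hφ.continuousOn_Icc 1)
  -- Grönwall's inequality, valid while ψ stays in the tube of radius δ where `hL` applies.
  have hgron : ∀ T ∈ Icc (0 : ℝ) 1, (∀ t ∈ Ico 0 T, ‖ψ t - φ t‖ ≤ δ) →
      ‖ψ T - φ T‖ ≤ ‖y - x‖ * Real.exp C := by
    intro T hT hin
    have := norm_le_gronwallBound_of_norm_deriv_right_le (f := fun t => ψ t - φ t)
      (f' := fun t => F (ψ t) - F (φ t)) (δ := ‖y - x‖) (K := C) (ε := 0) (a := 0) (b := T)
      (hcont.mono (Icc_subset_Icc_right hT.2))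
      (fun t ht => (hψ.deriv_right ht.1).sub (hφ.deriv_right ht.1))
      (by simp [hψ.init, hφ.init])
      (fun t ht => by
        simpa using hL t ⟨ht.1, ht.2.le.trans hT.2⟩ (ψ t) (by simpa [dist_eq_norm] using hin t ht))
      T ⟨hT.1, le_rfl⟩
    refine this.trans ?_
    rw [gronwallBound_ε0]
    gcongr
    nlinarith [hT.1, hT.2]
  by_contra! hne
  obtain ⟨t₁, ht₁, hlt₁⟩ := hne
  have hfar : ∃ t ∈ Icc (0 : ℝ) 1, δ < ‖ψ t - φ t‖ := by
    by_contra! hle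
    exact hlt₁.not_ge (hgron t₁ ht₁ fun t ht => hle t ⟨ht.1, ht.2.le.trans ht₁.2⟩)
  obtain ⟨t₂, ht₂, hlt₂⟩ := hfar
  have hcpt : IsCompact (Icc (0 : ℝ) 1 ∩ (fun t => ‖ψ t - φ t‖) ⁻¹' Ici δ) :=
    isCompact_Icc.of_isClosed_subset
      (hcont.norm.preimage_isClosed_of_isClosed isClosed_Icc isClosed_Ici) inter_subset_left
  -- At the first time the distance is at least δ, the Grönwall bound already puts it below δ.
  obtain ⟨τ, ⟨hτ, hτδ⟩, hmin⟩ := hcpt.exists_isLeast ⟨t₂, ht₂, hlt₂.le⟩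
  have := hgron τ hτ fun t ht => by
    by_contra! h
    exact ht.2.not_ge (hmin ⟨⟨ht.1, ht.2.le.trans hτ.2⟩, h.le⟩)
  have hτδ' : δ ≤ ‖ψ τ - φ τ‖ := hτδ
  linarith

/-- The time-one map is differentiable, and Liouville's formula gives its determinant. -/
theorem IsForwardTrajectory.exists_hasFDerivWithinAt (hX : IsOpen X) (hF : ContDiffOn ℝ 1 F X)
    (hφ : IsForwardTrajectory X F x φ) {Ω : Set (State n)} {T : State n → State n}
    (hx : x ∈ Ω) (hΩ : ∀ y ∈ Ω, ∃ ψ, IsForwardTrajectory X F y ψ ∧ T y = ψ 1) :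
    ∃ M : ℝ → State n →L[ℝ] State n, M 0 = ContinuousLinearMap.id ℝ _ ∧
      ContinuousOn M (Icc 0 1) ∧
      (∀ t ∈ Ico (0 : ℝ) 1, HasDerivWithinAt M (fderiv ℝ F (φ t) ∘L M t) (Ici t) t) ∧
      HasFDerivWithinAt T (M 1) Ω x := by
  have hcφ : ContinuousOn φ (Icc 0 1) := hφ.continuousOn_Icc 1
  have hKX : φ '' Icc 0 1 ⊆ X := by
    rintro _ ⟨t, ht, rfl⟩
    exact hφ.mem t ht.1
  obtain ⟨C, hC0, hCd, ⟨δ, hδ, hL⟩, hε⟩ := exists_uniform_expansion hX hF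
    (isCompact_Icc.image_of_continuousOn hcφ) hKX
  simp only [forall_mem_image] at hCd hL hε
  have hA : ContinuousOn (fun t => fderiv ℝ F (φ t)) (Icc 0 1) :=
    (hF.continuousOn_fderiv_of_isOpen hX le_rfl).comp hcφ fun t ht => hφ.mem t ht.1
  -- The operator-valued variational equation along φ.
  obtain ⟨M, hM0, hMc, hM⟩ := exists_linear_ODE
    (A := fun t => ContinuousLinearMap.compL ℝ (State n) (State n) (State n) (fderiv ℝ F (φ t)))
    ((ContinuousLinearMap.continuous _).comp_continuousOn hA) (ContinuousLinearMap.id ℝ _)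
  refine ⟨M, hM0, hMc, hM, ?_⟩
  set G : ℝ := gronwallBound 0 C 1 1 with hG
  have hG0 : 0 ≤ G := by
    rw [hG]
    refine le_trans ?_ (gronwallBound_mono le_rfl zero_le_one hC0 zero_le_one)
    rw [gronwallBound_x0]
  rw [hasFDerivWithinAt_iff_isLittleO, Asymptotics.isLittleO_iff]
  intro c hc
  -- Chosen so that ε · exp C · G ≤ c; the summand 1 keeps the denominator positive.
  set ε : ℝ := c / ((G + 1) * Real.exp C) with hεdef
  have hεpos : 0 < ε := by positivity
  obtain ⟨r, hr, hexp⟩ := hε ε hεpos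
  have hnear : ∀ᶠ y in 𝓝[Ω] x, ‖y - x‖ * Real.exp C < min δ r := by
    refine Filter.Eventually.filter_mono nhdsWithin_le_nhds ?_
    have h1 : Tendsto (fun y => ‖y - x‖ * Real.exp C) (𝓝 x) (𝓝 (‖x - x‖ * Real.exp C)) :=
      Continuous.tendsto (by fun_prop) x
    refine h1.eventually_lt_const ?_
    simp [hδ, hr]
  filter_upwards [hnear, self_mem_nhdsWithin] with y hy hyΩ
  obtain ⟨ψ, hψ, hTy⟩ := hΩ y hyΩ
  obtain ⟨φ', hφ', hTx⟩ := hΩ x hx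
  rw [hTy, hTx, hφ'.unique hX hF hφ zero_le_one]
  have hclose := hφ.norm_sub_le hC0 (fun t ht => hL ht) hψ (hy.trans_le (min_le_left _ _))
  -- The remainder ψ - φ - M(y - x) starts at 0 and is forced only by the Taylor error, at most ε‖y
  -- - x‖ exp C.
  have hbound := norm_le_gronwallBound_of_norm_deriv_right_le
    (f := fun t => ψ t - φ t - M t (y - x))
    (f' := fun t => F (ψ t) - F (φ t) - fderiv ℝ F (φ t) (M t (y - x)))
    (δ := 0) (K := C) (ε := ε * (‖y - x‖ * Real.exp C)) (a := 0) (b := 1)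
    (((hψ.continuousOn_Icc 1).sub hcφ).sub (hMc.clm_apply continuousOn_const))
    (fun t ht => ((hψ.deriv_right ht.1).sub (hφ.deriv_right ht.1)).sub (by
      simpa using (hM t ht).clm_apply (hasDerivWithinAt_const t (Ici t) (y - x))))
    (by simp [hψ.init, hφ.init, hM0])
    (fun t ht => by
      have ht' : t ∈ Icc (0 : ℝ) 1 := ⟨ht.1, ht.2.le⟩
      have h1 := hexp ht' (ψ t) (by
        rw [Metric.mem_closedBall, dist_eq_norm]
        exact (hclose t ht').trans (hy.le.trans (min_le_right _ _)))
      have h2 : F (ψ t) - F (φ t) - fderiv ℝ F (φ t) (M t (y - x))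
          = (F (ψ t) - F (φ t) - fderiv ℝ F (φ t) (ψ t - φ t))
            + fderiv ℝ F (φ t) (ψ t - φ t - M t (y - x)) := by
        rw [map_sub (fderiv ℝ F (φ t)) (ψ t - φ t)]
        abel
      rw [h2]
      calc _ ≤ ε * ‖ψ t - φ t‖ + ‖fderiv ℝ F (φ t)‖ * ‖ψ t - φ t - M t (y - x)‖ :=
            (norm_add_le _ _).trans (add_le_add h1 (ContinuousLinearMap.le_opNorm _ _))
        _ ≤ ε * (‖y - x‖ * Real.exp C) + C * ‖ψ t - φ t - M t (y - x)‖ := by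
            gcongr
            · exact hclose t ht'
            · exact hCd ht'
        _ = _ := add_comm _ _)
    1 ⟨zero_le_one, le_rfl⟩
  have hscale : ∀ e : ℝ, gronwallBound 0 C e 1 = e * G := by
    intro e
    simp only [hG, gronwallBound]
    split_ifs <;> ring
  rw [sub_zero, hscale] at hbound
  refine hbound.trans ?_
  have h3 : ε * (‖y - x‖ * Real.exp C) * G = c * ‖y - x‖ * (G / (G + 1)) := by
    rw [hεdef]
    field_simp
  rw [h3]
  exact mul_le_of_le_one_right (by positivity) (by
    rw [div_le_one (by positivity)]
    linarith)

end Trajectories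

/-! ### Divergence as a trace and its product rule -/

section Divergence

variable {n : ℕ}

theorem divergence_eq_trace (V : State n → State n) (x : State n) :
    divergence V x = LinearMap.trace ℝ (State n) (fderiv ℝ V x : State n →ₗ[ℝ] State n) := by
  rw [LinearMap.trace_eq_matrix_trace ℝ (EuclideanSpace.basisFun (Fin n) ℝ).toBasis, Matrix.trace]
  simp [divergence, LinearMap.toMatrix_apply]

theorem divergence_smul {ρ : State n → ℝ} {F : State n → State n} {x : State n}
    (hρ : DifferentiableAt ℝ ρ x) (hF : DifferentiableAt ℝ F x) :
    divergence (fun y => ρ y • F y) x = ρ x * divergence F x + fderiv ℝ ρ x (F x) := by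
  have h := (hρ.hasFDerivAt.smul hF.hasFDerivAt).fderiv
  unfold divergence
  have h1 : fderiv ℝ ρ x (F x) = ∑ i, fderiv ℝ ρ x (EuclideanSpace.single i 1) * F x i := by
    conv_lhs => rw [← (EuclideanSpace.basisFun (Fin n) ℝ).sum_repr (F x)]
    simp [map_sum, mul_comm]
  rw [h1, Finset.mul_sum, ← Finset.sum_add_distrib]
  refine Finset.sum_congr rfl fun i _ => ?_
  have h' : fderiv ℝ (fun y => ρ y • F y) x = _ := h
  rw [h']
  simp

theorem continuousOn_divergence {X : Set (State n)} {V : State n → State n} (hX : IsOpen X)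
    (hV : ContDiffOn ℝ 1 V X) : ContinuousOn (divergence V) X := by
  have h := hV.continuousOn_fderiv_of_isOpen hX le_rfl
  unfold divergence
  fun_prop

end Divergence

/-! ### Scalar inequalities from right derivatives -/

section Monotone

theorem le_of_deriv_right_nonneg {f f' : ℝ → ℝ} {a b : ℝ} (hf : ContinuousOn f (Icc a b))
    (hd : ∀ t ∈ Ico a b, HasDerivWithinAt f (f' t) (Ici t) t) (h0 : ∀ t ∈ Ico a b, 0 ≤ f' t)
    {t : ℝ} (ht : t ∈ Icc a b) : f a ≤ f t :=
  image_le_of_deriv_right_le_deriv_boundary (f := fun _ => f a) (f' := fun _ => 0) (B := f)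
    (B' := f') continuousOn_const (fun _ _ => hasDerivWithinAt_const _ _ _) le_rfl hf hd h0 ht

/-- A positive derivative at a gives a strict rise just after a, which monotonicity then preserves.
-/
theorem lt_of_deriv_right_nonneg {f f' : ℝ → ℝ} {a b : ℝ} (hab : a < b)
    (hf : ContinuousOn f (Icc a b))
    (hd : ∀ t ∈ Ico a b, HasDerivWithinAt f (f' t) (Ici t) t) (h0 : ∀ t ∈ Ico a b, 0 ≤ f' t)
    (hpos : 0 < f' a) : f a < f b := by
  have h1 : Tendsto (slope f a) (𝓝[>] a) (𝓝 (f' a)) :=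
    (hasDerivWithinAt_iff_tendsto_slope' self_notMem_Ioi).1 (hd a ⟨le_rfl, hab⟩).Ioi_of_Ici
  obtain ⟨t, ht, htab⟩ := ((h1.eventually_const_lt hpos).and
    (Ioo_mem_nhdsGT hab)).exists
  have hat : f a < f t := by
    rw [slope_def_field] at ht
    have := (div_pos_iff_of_pos_right (sub_pos.2 htab.1)).1 ht
    linarith
  refine hat.trans_le (le_of_deriv_right_nonneg (f' := f') (hf.mono ?_) (fun s hs => hd s ?_)
    (fun s hs => h0 s ?_) ⟨htab.2.le, le_rfl⟩)
  · exact Icc_subset_Icc_left htab.1.le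
  · exact ⟨htab.1.le.trans hs.1, hs.2⟩
  · exact ⟨htab.1.le.trans hs.1, hs.2⟩

/-- A solution of a scalar linear equation with positive initial value stays positive. -/
theorem pos_of_linear_deriv_right {d a : ℝ → ℝ} (ha : ContinuousOn a (Icc 0 1))
    (hd : ContinuousOn d (Icc 0 1))
    (hd' : ∀ t ∈ Ico (0 : ℝ) 1, HasDerivWithinAt d (a t * d t) (Ici t) t) (h0 : 0 < d 0) :
    ∀ t ∈ Icc (0 : ℝ) 1, 0 < d t := by
  -- Clamping time to [0, 1] makes the coefficient continuous on the whole line, so its primitive is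
  -- differentiable everywhere.
  set e : ℝ → ℝ := fun t => a (max 0 (min t 1)) with he
  have hec : Continuous e := ha.comp_continuous (by fun_prop) fun t =>
    ⟨le_max_left _ _, max_le zero_le_one (min_le_right _ _)⟩
  have hea : ∀ t ∈ Icc (0 : ℝ) 1, e t = a t := fun t ht => by
    simp [he, min_eq_left ht.2, max_eq_right ht.1]
  set I : ℝ → ℝ := fun t => ∫ s in (0 : ℝ)..t, e s with hI
  have hId : ∀ t, HasDerivAt I (e t) t := fun t =>
    intervalIntegral.integral_hasDerivAt_right (hec.intervalIntegrable _ _)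
      hec.aestronglyMeasurable.stronglyMeasurableAtFilter hec.continuousAt
  have hEd : ∀ t, HasDerivAt (fun t => Real.exp (-I t)) (Real.exp (-I t) * (-e t)) t := fun t =>
    (hId t).neg.exp
  -- Integrating factor: d · exp(-I) is constant.
  have hconst := constant_of_has_deriv_right_zero (f := fun t => d t * Real.exp (-I t)) (a := 0)
    (b := 1) (hd.mul fun t _ => (hEd t).continuousAt.continuousWithinAt) (fun t ht => by
      have h := (hd' t ht).mul (hEd t).hasDerivWithinAt
      have hz : a t * d t * Real.exp (-I t) + d t * (Real.exp (-I t) * (-e t)) = 0 := by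
        rw [hea t ⟨ht.1, ht.2.le⟩]
        ring
      rw [hz] at h
      exact h)
  intro t ht
  have h1 := hconst t ht
  have h2 : 0 < d 0 * Real.exp (-I 0) := by positivity
  rw [← h1] at h2
  exact pos_of_mul_pos_left h2 (Real.exp_pos _).le

end Monotone

/-! ### Expansion of the density and almost everywhere convergence -/

section Density

variable {n : ℕ} {X : Set (State n)} {F : State n → State n} {ρ : State n → ℝ}

/-- By backward uniqueness against the constant solution, trajectories never meet the singularity of
the density. -/
theorem ne_zero_of_trajectory (hX : IsOpen X) (h0X : (0 : State n) ∈ X) (hF : ContDiffOn ℝ 1 F X)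
    (hF0 : F 0 = 0) {x : State n} {φ : ℝ → State n} (hφ : IsForwardTrajectory X F x φ)
    (hx : x ≠ 0) {t : ℝ} (ht : 0 ≤ t) : φ t ≠ 0 := by
  have hzero : IsForwardTrajectory X F 0 (fun _ => 0) :=
    ⟨rfl, fun _ _ => h0X, fun t _ => by simpa [hF0] using hasDerivWithinAt_const t (Ici 0) 0⟩
  exact fun h => hx (hφ.unique_backward hX hF hzero ht h)

/-- A density with nonnegative divergence along the flow is expanded by the time-one map `T`. -/
theorem exists_hasFDerivWithinAt_density_le (hX : IsOpen X) (h0X : (0 : State n) ∈ X)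
    (hF : ContDiffOn ℝ 1 F X) (hF0 : F 0 = 0) (hρ : ContDiffOn ℝ 1 ρ (X \ {0}))
    (hdiv : ∀ x ∈ X \ {0}, 0 ≤ divergence (fun y => ρ y • F y) x)
    {x : State n} {φ : ℝ → State n} (hφ : IsForwardTrajectory X F x φ) (hx0 : x ≠ 0)
    {Ω : Set (State n)} {T : State n → State n}
    (hx : x ∈ Ω) (hΩ : ∀ y ∈ Ω, ∃ ψ, IsForwardTrajectory X F y ψ ∧ T y = ψ 1) :
    ∃ L : State n →L[ℝ] State n, HasFDerivWithinAt T L Ω x ∧ 0 < L.det ∧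
      ρ x ≤ L.det * ρ (φ 1) ∧
      (0 < divergence (fun y => ρ y • F y) x → ρ x < L.det * ρ (φ 1)) ∧
      (0 < ρ x → ∀ t ∈ Icc (0 : ℝ) 1, 0 < ρ (φ t)) := by
  obtain ⟨M, hM0, hMc, hM, hT⟩ := hφ.exists_hasFDerivWithinAt hX hF hx hΩ
  have hU : IsOpen (X \ {0}) := hX.sdiff isClosed_singleton
  have hmem : ∀ t, 0 ≤ t → φ t ∈ X \ {0} := fun t ht =>
    ⟨hφ.mem t ht, ne_zero_of_trajectory hX h0X hF hF0 hφ hx0 ht⟩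
  have hdet : ∀ t ∈ Ico (0 : ℝ) 1, HasDerivWithinAt (fun τ => (M τ).det)
      (divergence F (φ t) * (M t).det) (Ici t) t := fun t ht => by
    rw [divergence_eq_trace]
    exact hasDerivWithinAt_clm_det (hM t ht)
  have hdetc : ContinuousOn (fun τ => (M τ).det) (Icc 0 1) :=
    ContinuousLinearMap.continuous_det.comp_continuousOn hMc
  have hdet0 : (M 0).det = 1 := by simp [hM0, ContinuousLinearMap.det]
  have hpos := pos_of_linear_deriv_right
    ((continuousOn_divergence hX hF).comp (hφ.continuousOn_Icc 1) fun t ht => hφ.mem t ht.1)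
    hdetc hdet (by simp [hdet0])
  have hρd : ∀ y ∈ X \ {0}, DifferentiableAt ℝ ρ y := fun y hy =>
    (hρ.contDiffAt (hU.mem_nhds hy)).differentiableAt one_ne_zero
  -- Liouville's formula for det M and the chain rule for ρ ∘ φ add up to ∇·(ρF) = ρ ∇·F + ∇ρ·F.
  have hJ : ∀ t ∈ Ico (0 : ℝ) 1, HasDerivWithinAt (fun τ => (M τ).det * ρ (φ τ))
      ((M t).det * divergence (fun y => ρ y • F y) (φ t)) (Ici t) t := fun t ht => by
    have h1 := (hρd _ (hmem t ht.1)).hasFDerivAt.comp_hasDerivWithinAt t (hφ.deriv_right ht.1)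
    have h2 := (hdet t ht).mul h1
    have h3 : (M t).det * divergence (fun y => ρ y • F y) (φ t)
        = divergence F (φ t) * (M t).det * (ρ ∘ φ) t
          + (M t).det * fderiv ℝ ρ (φ t) (F (φ t)) := by
      rw [divergence_smul (hρd _ (hmem t ht.1))
        ((contDiffAt_of_isOpen hX hF (hφ.mem t ht.1)).differentiableAt one_ne_zero)]
      simp only [Function.comp_apply]
      ring
    rw [h3]
    exact h2
  have hJc : ContinuousOn (fun τ => (M τ).det * ρ (φ τ)) (Icc 0 1) :=
    hdetc.mul (hρ.continuousOn.comp (hφ.continuousOn_Icc 1) fun t ht => hmem t ht.1)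
  have hJ0 : ∀ t ∈ Ico (0 : ℝ) 1, 0 ≤ (M t).det * divergence (fun y => ρ y • F y) (φ t) :=
    fun t ht => mul_nonneg (hpos t ⟨ht.1, ht.2.le⟩).le (hdiv _ (hmem t ht.1))
  have hle : ∀ t ∈ Icc (0 : ℝ) 1, ρ x ≤ (M t).det * ρ (φ t) := fun t ht => by
    simpa [hdet0, hφ.init] using le_of_deriv_right_nonneg hJc hJ hJ0 ht
  have h1 : (1 : ℝ) ∈ Icc (0 : ℝ) 1 := ⟨zero_le_one, le_rfl⟩
  refine ⟨M 1, hT, hpos 1 h1, hle 1 h1, fun hlt => ?_, fun hρx t ht => ?_⟩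
  · simpa [hdet0, hφ.init] using lt_of_deriv_right_nonneg zero_lt_one hJc hJ hJ0
      (by simpa [hdet0, hφ.init] using hlt)
  · exact pos_of_mul_pos_right (hρx.trans_le (hle t ht)) (hpos t ht).le

/-- A density with nonnegative divergence stays positive along trajectories. -/
theorem density_pos_of_trajectory (hX : IsOpen X) (h0X : (0 : State n) ∈ X)
    (hF : ContDiffOn ℝ 1 F X) (hF0 : F 0 = 0) (hρ : ContDiffOn ℝ 1 ρ (X \ {0}))
    (hdiv : ∀ x ∈ X \ {0}, 0 ≤ divergence (fun y => ρ y • F y) x)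
    {x : State n} {φ : ℝ → State n} (hφ : IsForwardTrajectory X F x φ) (hx0 : x ≠ 0)
    (hρx : 0 < ρ x) {t : ℝ} (ht : 0 ≤ t) : 0 < ρ (φ t) := by
  have step : ∀ s, 0 ≤ s → 0 < ρ (φ s) → ∀ r ∈ Icc (0 : ℝ) 1, 0 < ρ (φ (s + r)) := by
    intro s hs hρs
    -- Only the positivity conclusion is wanted, so a one-point Ω suffices.
    obtain ⟨L, -, -, -, -, h⟩ := exists_hasFDerivWithinAt_density_le hX h0X hF hF0 hρ hdiv
      (hφ.shift hs) (ne_zero_of_trajectory hX h0X hF hF0 hφ hx0 hs) (mem_singleton (φ s))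
      (T := fun _ => φ (s + 1)) (fun y hy => ⟨fun r => φ (s + r), by
        rw [mem_singleton_iff.1 hy]
        exact hφ.shift hs, rfl⟩)
    exact h hρs
  have hnat : ∀ j : ℕ, 0 < ρ (φ j) := by
    intro j
    induction j with
    | zero => simpa [hφ.init] using hρx
    | succ j ih => simpa using step j j.cast_nonneg ih 1 ⟨zero_le_one, le_rfl⟩
  have := step ⌊t⌋₊ (Nat.cast_nonneg _) (hnat _) (t - ⌊t⌋₊)
    ⟨sub_nonneg.2 (Nat.floor_le ht), by linarith [Nat.lt_floor_add_one t]⟩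
  simpa using this

/-- A trajectory whose integer-time samples tend to an equilibrium at the origin tends to it. -/
theorem IsForwardTrajectory.tendsto_zero_of_nat (hX : IsOpen X) (h0X : (0 : State n) ∈ X)
    (hF : ContDiffOn ℝ 1 F X) (hF0 : F 0 = 0) {x : State n} {φ : ℝ → State n}
    (hφ : IsForwardTrajectory X F x φ) (h : Tendsto (fun j : ℕ => φ j) atTop (𝓝 0)) :
    Tendsto φ atTop (𝓝 0) := by
  have hzero : IsForwardTrajectory X F 0 (fun _ => 0) :=
    ⟨rfl, fun _ _ => h0X, fun t _ => by simpa [hF0] using hasDerivWithinAt_const t (Ici 0) 0⟩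
  obtain ⟨C, hC0, -, ⟨δ, hδ, hL⟩, -⟩ := exists_uniform_expansion hX hF
    (isCompact_singleton (x := (0 : State n))) (singleton_subset_iff.2 h0X)
  rw [Metric.tendsto_atTop]
  intro ε hε
  -- Compared with the zero solution, the state during one unit of time is at most exp C times the
  -- preceding sample.
  have h1 : Tendsto (fun j : ℕ => ‖φ j‖ * Real.exp C) atTop (𝓝 0) := by
    simpa using h.norm.mul_const (Real.exp C)
  obtain ⟨N, hN⟩ := eventually_atTop.1 (h1.eventually_lt_const (lt_min hδ hε))
  refine ⟨N, fun t ht => ?_⟩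
  have ht0 : 0 ≤ t := N.cast_nonneg.trans ht
  have hj := hN ⌊t⌋₊ (Nat.le_floor ht)
  have := hzero.norm_sub_le hC0 (fun t _ => hL 0 (mem_singleton 0))
    (hφ.shift (Nat.cast_nonneg ⌊t⌋₊)) (by simpa using hj.trans_le (min_le_left _ _)) (t - ⌊t⌋₊)
    ⟨sub_nonneg.2 (Nat.floor_le ht0), by linarith [Nat.lt_floor_add_one t]⟩
  simp only [add_sub_cancel, sub_zero] at this
  rw [dist_zero_right]
  exact this.trans_lt (hj.trans_le (min_le_right _ _))

/-- **Rantzer's density criterion**: almost every complete trajectory starting where the divergence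
of `ρ F` is positive converges to the origin. -/
theorem ae_tendsto_zero_of_density (hX : IsOpen X) (h0X : (0 : State n) ∈ X)
    (hF : ContDiffOn ℝ 1 F X) (hF0 : F 0 = 0) (hρ : ContDiffOn ℝ 1 ρ (X \ {0}))
    (hρ0 : ∀ x ∈ X \ {0}, 0 ≤ ρ x)
    (hint : ∀ η : ℝ, 0 < η → IntegrableOn ρ (X \ Metric.ball 0 η) volume)
    (hdiv : ∀ x ∈ X \ {0}, 0 ≤ divergence (fun y => ρ y • F y) x)
    {X₀ : Set (State n)} (hX₀ : MeasurableSet X₀) (hX₀X : X₀ ⊆ X \ {0})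
    (hcomplete : ∀ x ∈ X₀, ∃ φ, IsForwardTrajectory X F x φ)
    (hdiv₀ : ∀ x ∈ X₀, 0 < divergence (fun y => ρ y • F y) x) :
    ∀ᵐ x ∂(volume.restrict X₀), ∀ φ, IsForwardTrajectory X F x φ → Tendsto φ atTop (𝓝 0) := by
  classical
  -- Ω is invariant but not known to be measurable. The measure argument therefore runs on the union
  -- S of the forward images of X₀.
  set Ω : Set (State n) := {x | x ≠ 0 ∧ ∃ φ, IsForwardTrajectory X F x φ} with hΩdef
  have hΦ : ∀ x, ∃ φ : ℝ → State n, x ∈ Ω → IsForwardTrajectory X F x φ := fun x => by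
    by_cases hx : x ∈ Ω
    · obtain ⟨φ, hφ⟩ := hx.2
      exact ⟨φ, fun _ => hφ⟩
    · exact ⟨fun _ => 0, fun h => absurd h hx⟩
  choose Φ hΦ using hΦ
  set T : State n → State n := fun x => Φ x 1 with hTdef
  have hΩT : ∀ y ∈ Ω, ∃ ψ, IsForwardTrajectory X F y ψ ∧ T y = ψ 1 :=
    fun y hy => ⟨Φ y, hΦ y hy, rfl⟩
  have hΩX : Ω ⊆ X \ {0} := fun x hx => ⟨by
    have := (hΦ x hx).mem 0 le_rfl
    rwa [(hΦ x hx).init] at this, hx.1⟩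
  have hΩφ : ∀ {x φ}, x ∈ Ω → IsForwardTrajectory X F x φ → ∀ t, 0 ≤ t → φ t ∈ Ω :=
    fun hx hφ t ht => ⟨ne_zero_of_trajectory hX h0X hF hF0 hφ hx.1 ht, _, hφ.shift ht⟩
  have hTΩ : MapsTo T Ω Ω := fun x hx => hΩφ hx (hΦ x hx) 1 zero_le_one
  have hinj : InjOn T Ω := fun x hx y hy h =>
    (hΦ x hx).unique_backward hX hF (hΦ y hy) zero_le_one h
  have hX₀Ω : X₀ ⊆ Ω := fun x hx => ⟨(hX₀X hx).2, hcomplete x hx⟩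
  have hL : ∀ x, ∃ L : State n →L[ℝ] State n, x ∈ Ω → HasFDerivWithinAt T L Ω x ∧ 0 < L.det ∧
      ρ x ≤ L.det * ρ (T x) ∧
      (0 < divergence (fun y => ρ y • F y) x → ρ x < L.det * ρ (T x)) := fun x => by
    by_cases hx : x ∈ Ω
    · obtain ⟨L, h1, h2, h3, h4, -⟩ := exists_hasFDerivWithinAt_density_le hX h0X hF hF0 hρ hdiv
        (hΦ x hx) hx.1 hx hΩT
      exact ⟨L, fun _ => ⟨h1, h2, h3, h4⟩⟩
    · exact ⟨0, fun h => absurd h hx⟩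
  choose T' hT' using hL
  have hTc : ContinuousOn T Ω := fun x hx => (hT' x hx).1.continuousWithinAt
  have himg : ∀ j : ℕ, MeasurableSet (T^[j] '' X₀) ∧ T^[j] '' X₀ ⊆ Ω := by
    intro j
    induction j with
    | zero => simpa using ⟨hX₀, hX₀Ω⟩
    | succ j ih =>
      rw [Function.iterate_succ', image_comp]
      -- Lusin–Souslin: a continuous injective image of a Borel set is Borel.
      exact ⟨ih.1.image_of_continuousOn_injOn (hTc.mono ih.2) (hinj.mono ih.2),
        (hTΩ.mono_left ih.2).image_subset⟩
  set S : Set (State n) := ⋃ j, T^[j] '' X₀ with hSdef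
  have hSΩ : S ⊆ Ω := iUnion_subset fun j => (himg j).2
  have hTS : MapsTo T S S := by
    intro x hx
    obtain ⟨j, y, hy, rfl⟩ := mem_iUnion.1 hx
    exact mem_iUnion.2 ⟨j + 1, y, hy, Function.iterate_succ_apply' T j y⟩
  have hU : IsOpen (X \ {0}) := hX.sdiff isClosed_singleton
  -- Cutting off outside X \ {0}, where ρ is uncontrolled, makes r measurable.
  set r : State n → ENNReal := fun x => ENNReal.ofReal ((X \ {0}).indicator ρ x) with hr
  have hrm : Measurable r := by
    refine ENNReal.measurable_ofReal.comp ?_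
    rw [← piecewise_eq_indicator]
    exact hρ.continuousOn.measurable_piecewise continuousOn_const hU.measurableSet
  have hrΩ : ∀ x ∈ Ω, r x = ENNReal.ofReal (ρ x) := fun x hx => by
    rw [hr]
    simp only [indicator_of_mem (hΩX hx)]
  have hJ : ∀ x ∈ Ω, ENNReal.ofReal |(T' x).det| * r (T x)
      = ENNReal.ofReal ((T' x).det * ρ (T x)) := fun x hx => by
    rw [hrΩ _ (hTΩ hx), abs_of_pos (hT' x hx).2.1, ENNReal.ofReal_mul (hT' x hx).2.1.le]
  have hev : ∀ N : ℕ, ∀ᵐ x ∂(volume.restrict X₀), ∀ᶠ j in atTop,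
      T^[j] x ∉ (Metric.ball (0 : State n) (1 / (N + 1)))ᶜ := by
    intro N
    refine ae_eventually_iterate_notMem volume (S := S) (T' := T') (ρ := r)
      (MeasurableSet.iUnion fun j => (himg j).1) hX₀
      (fun x hx => mem_iUnion.2 ⟨0, x, hx, rfl⟩) hTS (hinj.mono hSΩ)
      (fun x hx => (hT' x (hSΩ hx)).1.mono hSΩ) hrm (fun x hx => ?_) (fun x hx => ?_)
      Metric.isOpen_ball.measurableSet.compl ?_
    · rw [hJ x (hSΩ hx), hrΩ x (hSΩ hx)]
      exact ENNReal.ofReal_le_ofReal (hT' x (hSΩ hx)).2.2.1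
    · have hlt := (hT' x (hX₀Ω hx)).2.2.2 (hdiv₀ x hx)
      rw [hJ x (hX₀Ω hx), hrΩ x (hX₀Ω hx)]
      exact (ENNReal.ofReal_lt_ofReal_iff ((hρ0 x (hX₀X hx)).trans_lt hlt)).2 hlt
    · have hfin := (hint (1 / (N + 1)) (by positivity)).lintegral_lt_top
      refine ne_top_of_le_ne_top hfin.ne ?_
      calc _ ≤ ∫⁻ x in X \ Metric.ball 0 (1 / (N + 1)), r x :=
            lintegral_mono_set fun x hx => ⟨(hΩX (hSΩ hx.2)).1, hx.1⟩
        _ ≤ _ := by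
          refine setLIntegral_mono' (hX.measurableSet.diff Metric.isOpen_ball.measurableSet)
            fun x hx => ?_
          have hx0 : x ∈ X \ {0} := ⟨hx.1, fun h => hx.2 (by
            rw [mem_singleton_iff.1 h]
            exact Metric.mem_ball_self (by positivity))⟩
          simp only [hr, indicator_of_mem hx0, le_refl]
  have hiter : ∀ x ∈ Ω, ∀ φ, IsForwardTrajectory X F x φ → ∀ j : ℕ, T^[j] x = φ j := by
    intro x hx φ hφ j
    induction j with
    | zero => simp [hφ.init]
    | succ j ih =>
      rw [Function.iterate_succ_apply', ih]
      have hj : (0 : ℝ) ≤ j := j.cast_nonneg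
      have := (hΦ _ (hΩφ hx hφ j hj)).unique hX hF (hφ.shift hj) zero_le_one
      simpa using this
  filter_upwards [ae_all_iff.2 hev, ae_restrict_mem hX₀] with x hx hxX₀ φ hφ
  refine hφ.tendsto_zero_of_nat hX h0X hF hF0 ?_
  rw [Metric.tendsto_nhds]
  intro ε hε
  obtain ⟨N, hN⟩ := exists_nat_one_div_lt hε
  filter_upwards [hx N] with j hj
  rw [hiter x (hX₀Ω hxX₀) φ hφ j, notMem_compl_iff] at hj
  exact (Metric.mem_ball.1 hj).trans hN

end Density

/-! ### Signs and regularity of the factors of the density -/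

section Bump

variable {n : ℕ}

theorem inverseBump_eq_zero {c b : State n → ℝ} {x : State n} (h : c x ≤ 0) :
    inverseBump c b x = 0 :=
  if_pos h

theorem inverseBump_pos {c b : State n → ℝ} {x : State n} (h : 0 < c x) :
    0 < inverseBump c b x := by
  unfold inverseBump
  rw [if_neg h.not_ge]
  split_ifs with hb
  · exact Real.smoothTransition.pos_of_pos (div_pos h (by linarith))
  · exact one_pos

theorem inverseBump_nonneg (c b : State n → ℝ) (x : State n) : 0 ≤ inverseBump c b x := by
  rcases le_or_gt (c x) 0 with h | h
  · exact (inverseBump_eq_zero h).ge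
  · exact (inverseBump_pos h).le

theorem quadDist_smul (P : Matrix (Fin n) (Fin n) ℝ) (s : ℝ) (x : State n) :
    quadDist P (s • x) = s ^ 2 * quadDist P x := by
  simp only [quadDist, WithLp.ofLp_smul, Matrix.mulVec_smul, smul_dotProduct, dotProduct_smul,
    smul_eq_mul]
  ring

theorem contDiff_quadDist (P : Matrix (Fin n) (Fin n) ℝ) : ContDiff ℝ 1 (quadDist P) := by
  unfold quadDist dotProduct Matrix.mulVec dotProduct
  fun_prop

theorem quadDist_pos {P : Matrix (Fin n) (Fin n) ℝ} (hP : P.PosDef) {x : State n} (hx : x ≠ 0) :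
    0 < quadDist P x := by
  have h : x.ofLp ≠ 0 := fun h => hx (by
    ext i
    simp [h])
  simpa [quadDist] using hP.dotProduct_mulVec_pos h

end Bump

/-! ### The target is an equilibrium -/

section Equilibrium

variable {n : ℕ} {X : Set (State n)} {F : State n → State n} {Ψ D : State n → ℝ} {α : ℝ}

/-- Multiplying by D^(α + 1) clears the singularity, so the sign of the divergence can be examined
near the origin. -/
theorem rpow_mul_divergence_smul {x : State n} (hD : 0 < D x) (hDd : DifferentiableAt ℝ D x)
    (hΨ : DifferentiableAt ℝ Ψ x) (hF : DifferentiableAt ℝ F x) :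
    D x ^ (α + 1) * divergence (fun y => (Ψ y / D y ^ α) • F y) x
      = D x * (Ψ x * divergence F x + fderiv ℝ Ψ x (F x)) - α * Ψ x * fderiv ℝ D x (F x) := by
  have h1 : HasFDerivAt (fun y => D y ^ (-α)) ((-α * D x ^ (-α - 1)) • fderiv ℝ D x) x :=
    hDd.hasFDerivAt.rpow_const (Or.inl hD.ne')
  have h2 := hΨ.hasFDerivAt.mul h1
  have hev : (fun y => Ψ y / D y ^ α) =ᶠ[𝓝 x] (fun y => Ψ y * D y ^ (-α)) := by
    filter_upwards [hDd.continuousAt.eventually_const_lt hD] with y hy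
    rw [Real.rpow_neg hy.le, div_eq_mul_inv]
  have h3 := h2.congr_of_eventuallyEq hev
  rw [divergence_smul h3.differentiableAt hF, h3.fderiv]
  have e1 : D x ^ (α + 1) = D x ^ α * D x := by rw [Real.rpow_add hD, Real.rpow_one]
  have e2 : D x ^ (-α) = (D x ^ α)⁻¹ := Real.rpow_neg hD.le α
  have e3 : D x ^ (-α - 1) = (D x ^ α)⁻¹ * (D x)⁻¹ := by
    rw [Real.rpow_sub hD, e2, Real.rpow_one, div_eq_mul_inv]
  have hpos : 0 < D x ^ α := Real.rpow_pos_of_pos hD α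
  simp only [_root_.add_apply, _root_.smul_apply, smul_eq_mul, e1, e2, e3]
  field_simp
  ring

/-- The singularity of the density forces the target to be an equilibrium. -/
theorem eq_zero_of_divergence_nonneg (hX : IsOpen X) (h0X : (0 : State n) ∈ X)
    (hF : ContDiffOn ℝ 1 F X) (hΨ : ContDiffOn ℝ 1 Ψ X) (hΨ0 : 0 < Ψ 0) (hD : ContDiff ℝ 1 D)
    (hDs : ∀ (s : ℝ) x, D (s • x) = s ^ 2 * D x) (hDpos : ∀ x, x ≠ 0 → 0 < D x) (hα : 0 < α)
    (hdiv : ∀ x ∈ X \ {0}, 0 ≤ divergence (fun y => (Ψ y / D y ^ α) • F y) x) : F 0 = 0 := by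
  by_contra hv
  set v := F 0 with hvdef
  have hDd : Differentiable ℝ D := hD.differentiable one_ne_zero
  have hscale : ∀ s : ℝ, s ≠ 0 → fderiv ℝ D (s • v) = s • fderiv ℝ D v := by
    intro s hs
    have h1 : fderiv ℝ (fun x => D (s • x)) v = s ^ 2 • fderiv ℝ D v := by
      simp only [hDs]
      exact fderiv_const_mul (hDd v) (s ^ 2)
    rw [fderiv_comp_smul] at h1
    have h2 : s • fderiv ℝ D (s • v) = s • (s • fderiv ℝ D v) := by
      rw [h1, smul_smul, sq]
    exact smul_right_injective _ hs h2
  -- Euler's identity for a function homogeneous of degree two.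
  have heuler : fderiv ℝ D v v = 2 * D v := by
    have h1 : HasDerivAt (fun s : ℝ => D (s • v)) (fderiv ℝ D v v) 1 := by
      have hs : HasDerivAt (fun s : ℝ => s • v) v 1 := by
        simpa using (hasDerivAt_id (1 : ℝ)).smul_const v
      exact HasFDerivAt.comp_hasDerivAt 1 (by simpa using (hDd v).hasFDerivAt) hs
    have h2 : HasDerivAt (fun s : ℝ => D (s • v)) (2 * D v) 1 := by
      simp only [hDs]
      simpa using ((hasDerivAt_id (1 : ℝ)).pow 2).mul_const (D v)
    exact h1.unique h2
  have hF0 : ContDiffAt ℝ 1 F 0 := contDiffAt_of_isOpen hX hF h0X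
  have hXn : X ∈ 𝓝 (0 : State n) := hX.mem_nhds h0X
  have hΨc : ContinuousAt Ψ 0 := hΨ.continuousOn.continuousAt hXn
  have hΨ'c : ContinuousAt (fderiv ℝ Ψ) 0 :=
    (hΨ.continuousOn_fderiv_of_isOpen hX le_rfl).continuousAt hXn
  have hdc : ContinuousAt (divergence F) 0 := (continuousOn_divergence hX hF).continuousAt hXn
  have hq : ContinuousAt (fun x => Ψ x * divergence F x + fderiv ℝ Ψ x (F x)) 0 :=
    (hΨc.mul hdc).add (hΨ'c.clm_apply hF0.continuousAt)
  have hp : ContinuousAt (fun x => α * Ψ x * fderiv ℝ D v (F x)) 0 :=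
    (hΨc.const_mul α).mul ((fderiv ℝ D v).continuous.continuousAt.comp hF0.continuousAt)
  have hline : Tendsto (fun s : ℝ => s • v) (𝓝[>] 0) (𝓝 0) := by
    have h1 : Continuous fun s : ℝ => s • v := by fun_prop
    exact (h1.tendsto' 0 0 (zero_smul ℝ v)).mono_left nhdsWithin_le_nhds
  have hid : Tendsto (fun s : ℝ => s) (𝓝[>] 0) (𝓝 0) := tendsto_id.mono_left nhdsWithin_le_nhds
  -- At s v the cleared divergence is s times this expression, because D scales by s² and its
  -- derivative by s. The limit is -2αΨ(0)D(v) < 0.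
  have hlim := ((hid.mul_const (D v)).mul (hq.tendsto.comp hline)).sub (hp.tendsto.comp hline)
  have hneg : 0 * D v * (Ψ 0 * divergence F 0 + fderiv ℝ Ψ 0 (F 0))
      - α * Ψ 0 * fderiv ℝ D v (F 0) < 0 := by
    rw [← hvdef, heuler]
    have : 0 < α * Ψ 0 * (2 * D v) := mul_pos (mul_pos hα hΨ0) (mul_pos two_pos (hDpos v hv))
    linarith
  obtain ⟨s, hs, hsX, hs0⟩ := ((hlim.eventually_lt_const hneg).and
    ((hline.eventually hXn).and self_mem_nhdsWithin)).exists
  have hs0' : 0 < s := hs0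
  have hsv : s • v ≠ 0 := smul_ne_zero hs0'.ne' hv
  have hsX' : s • v ∈ X := hsX
  have hfin := rpow_mul_divergence_smul (α := α) (hDpos _ hsv) (hDd _)
    ((hΨ.contDiffAt (hX.mem_nhds hsX')).differentiableAt one_ne_zero)
    ((contDiffAt_of_isOpen hX hF hsX').differentiableAt one_ne_zero)
  have hnn : 0 ≤ D (s • v) ^ (α + 1) * divergence (fun y => (Ψ y / D y ^ α) • F y) (s • v) :=
    mul_nonneg (Real.rpow_nonneg (hDpos _ hsv).le _) (hdiv _ ⟨hsX', hsv⟩)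
  rw [hfin, hscale s hs0'.ne', hDs] at hnn
  simp only [Function.comp_apply] at hs
  simp only [_root_.smul_apply, smul_eq_mul] at hnn
  nlinarith

end Equilibrium

/-! ### From almost everywhere to everywhere, and the main theorem -/

/-- A continuous function that is almost everywhere nonnegative away from the origin is nonnegative
away from the origin. -/
theorem nonneg_of_ae_nonneg {n : ℕ} {X : Set (State n)} (hX : IsOpen X) {q : State n → ℝ}
    (hq : ContinuousOn q (X \ {0}))
    (h : ∀ η : ℝ, 0 < η → ∀ᵐ x ∂(volume.restrict (X \ Metric.ball 0 η)), 0 ≤ q x) :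
    ∀ x ∈ X \ {0}, 0 ≤ q x := by
  intro x hx
  by_contra! hneg
  have hU : IsOpen (X \ {0}) := hX.sdiff isClosed_singleton
  have hx0 : 0 < ‖x‖ := norm_pos_iff.2 hx.2
  have hae := h (‖x‖ / 2) (by positivity)
  rw [ae_restrict_iff' (hX.measurableSet.diff Metric.isOpen_ball.measurableSet), ae_iff] at hae
  refine (Measure.measure_pos_of_mem_nhds (x := x) volume ?_).ne' hae
  filter_upwards [(hq.continuousAt (hU.mem_nhds hx)).eventually_lt_const hneg, hX.mem_nhds hx.1,
    continuous_norm.continuousAt.eventually_const_lt (half_lt_self hx0)] with y hy hyX hyx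
  exact fun hcon => hy.not_ge (hcon ⟨hyX, fun hb => hyx.not_gt (by simpa using hb)⟩)

end SafeNavigation

theorem mainTheorem1 {n m K : ℕ}
    -- the open state space, containing the target
    (X : Set (State n)) (hX : IsOpen X) (h0X : (0 : State n) ∈ X)
    -- the control-affine system
    (f : State n → State n) (hf : ContDiffOn ℝ 1 f X)
    (g : Fin m → State n → State n) (hg : ∀ j, ContDiffOn ℝ 1 (g j) X)
    -- obstacle and sensing functions, and smoothness of the inverse bump functions
    (c b : Fin K → State n → ℝ)
    (hc : ∀ i, ContinuousOn (c i) X) (hb : ∀ i, ContinuousOn (b i) X)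
    (hΨ : ∀ i, ContDiffOn ℝ 1 (inverseBump (c i) (b i)) X)
    (h0 : (0 : State n) ∉ obstacleRegion X c)
    -- the parameters of the density, which is integrable away from the target
    (P : Matrix (Fin n) (Fin n) ℝ) (hP : P.PosDef) (α : ℝ) (hα : 0 < α)
    (hρ : ∀ η : ℝ, 0 < η → IntegrableOn (density c b P α) (X \ Metric.ball 0 η) volume)
    -- the initial set
    (X₀ : Set (State n)) (hX₀ : MeasurableSet X₀) (hX₀X : X₀ ⊆ X \ {0})
    -- the feedback, with closed-loop trajectories from `X₀` defined for all `t ≥ 0`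
    (k : State n → EuclideanSpace ℝ (Fin m)) (hk : ContDiffOn ℝ 1 k X)
    (hcomplete : ∀ x₀ ∈ X₀, ∃ φ, IsForwardTrajectory X (closedLoop f g k) x₀ φ)
    (lam : ℝ) (hlam : 0 < lam)
    -- the two divergence conditions
    (hdiv : ∀ η : ℝ, 0 < η → ∀ᵐ x ∂(volume.restrict (X \ Metric.ball 0 η)),
      0 ≤ divergence (fun y => density c b P α y • closedLoop f g k y) x)
    (hdiv₀ : ∀ x ∈ X₀,
      lam ≤ divergence (fun y => density c b P α y • closedLoop f g k y) x) :
    SolvesAESafeNavigation X (closedLoop f g k) X₀ (obstacleRegion X c) := by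
  set F := closedLoop f g k with hFdef
  set ρ := density c b P α with hρdef
  set Ψ : State n → ℝ := fun x => ∏ i : Fin K, inverseBump (c i) (b i) x with hΨdef
  have hF : ContDiffOn ℝ 1 F X := by
    refine hf.add (ContDiffOn.sum fun j _ => ContDiffOn.fun_smul ?_ (hg j))
    exact (EuclideanSpace.proj (𝕜 := ℝ) j).contDiff.comp_contDiffOn hk
  have hU : IsOpen (X \ {0}) := hX.sdiff isClosed_singleton
  have hΨC : ContDiffOn ℝ 1 Ψ X := contDiffOn_prod fun i _ => hΨ i
  have hDU : ∀ x ∈ X \ {0}, 0 < quadDist P x := fun x hx => quadDist_pos hP hx.2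
  have hρC : ContDiffOn ℝ 1 ρ (X \ {0}) :=
    (hΨC.mono sdiff_subset).div ((contDiff_quadDist P).contDiffOn.rpow_const_of_ne
      fun x hx => (hDU x hx).ne') fun x hx => (Real.rpow_pos_of_pos (hDU x hx) α).ne'
  have hρ0 : ∀ x ∈ X \ {0}, 0 ≤ ρ x := fun x hx =>
    div_nonneg (Finset.prod_nonneg fun i _ => inverseBump_nonneg _ _ _)
      (Real.rpow_nonneg (hDU x hx).le α)
  have hρXu : ∀ x ∈ obstacleRegion X c, ρ x = 0 := by
    intro x hx
    obtain ⟨i, hi⟩ := mem_iUnion.1 hx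
    have : ∏ i : Fin K, inverseBump (c i) (b i) x = 0 :=
      Finset.prod_eq_zero (Finset.mem_univ i) (inverseBump_eq_zero hi.2)
    simp only [hρdef, density, this, zero_div]
  have hdivU := nonneg_of_ae_nonneg hX
    (continuousOn_divergence hU (hρC.fun_smul (hF.mono sdiff_subset))) hdiv
  have hΨ0 : 0 < Ψ 0 := Finset.prod_pos fun i _ => inverseBump_pos (by
    by_contra! hle
    exact h0 (mem_iUnion.2 ⟨i, h0X, hle⟩))
  have hF0 : F 0 = 0 := eq_zero_of_divergence_nonneg hX h0X hF hΨC hΨ0 (contDiff_quadDist P)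
    (quadDist_smul P) (fun x hx => quadDist_pos hP hx) hα hdivU
  -- At a zero, ρ has a local minimum, so both terms of ρ ∇·F + ∇ρ·F vanish, against the lower bound
  -- λ.
  have hρ₀ : ∀ x ∈ X₀, 0 < ρ x := by
    intro x hx
    refine (hρ0 x (hX₀X hx)).lt_of_ne fun hzero => ?_
    have hmin : IsLocalMin ρ x := by
      filter_upwards [hU.mem_nhds (hX₀X hx)] with y hy
      rw [← hzero]
      exact hρ0 y hy
    have h := hdiv₀ x hx
    rw [divergence_smul ((hρC.contDiffAt (hU.mem_nhds (hX₀X hx))).differentiableAt one_ne_zero)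
      ((contDiffAt_of_isOpen hX hF (hX₀X hx).1).differentiableAt one_ne_zero),
      hmin.fderiv_eq_zero, ← hzero] at h
    simp only [zero_mul, _root_.zero_apply, add_zero] at h
    exact hlam.not_ge h
  have hconv := ae_tendsto_zero_of_density hX h0X hF hF0 hρC hρ0 hρ hdivU hX₀ hX₀X hcomplete
    fun x hx => hlam.trans_le (hdiv₀ x hx)
  filter_upwards [hconv, ae_restrict_mem hX₀] with x hx hxX₀
  refine ⟨hcomplete x hxX₀, fun φ hφ => ⟨hx φ hφ, fun t ht hmem => ?_⟩⟩
  exact (density_pos_of_trajectory hX h0X hF hF0 hρC hdivU hφ (hX₀X hxX₀).2 (hρ₀ x hxX₀)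
    ht).ne' (hρXu _ hmem)
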